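/- Let $p$ be a prime, let $K$ be a field of characteristic $p$, and let $\delta:K\to K$ be a derivation with field of constants $F=\{a\in K\mid\delta(a)=0\}$, such that $\delta$, viewed as an $F$-linear endomorphism of $K$, has minimum polynomial $t^p-t\in F[t]$. Let $x$ be an indeterminate and extend $\delta$ to the derivation of $K(x)$, again denoted $\delta$, with $\delta(x)=0$. Then the field of constants of the extended $\delta$ is $F(x)$, and its minimum polynomial over $F(x)$ is again $t^p-t$. Let $R=K(x)[t;\delta]$ be the differential polynomial ring, whose elements are the polynomials $\sum_i a_it^i$ with $a_i\in K(x)$, with termwise addition and multiplication determined by $ta=at+\delta(a)$ for $a\in K(x)$. For $h(x)\in K(x)$ put $f(t)=t^p-t-h(x)\in R$, and let $(K(x),\delta,h(x))=R/Rf$ be the set of all $g\in R$ of degree less than $p$ with the multiplication $g\circ g'=gg'\ \mathrm{mod}_r f$, where $\mathrm{mod}_r f$ denotes the remainder $r$ in the right division $gg'=qf+r$, $\deg r<p$. Then for every $h(x)\in K(x)\setminus F(x)$: 1. $f(t)=t^p-t-h(x)$ is irreducible in $R$; 2. $A=(K(x),\delta,h(x))$ is a unital division algebra over $F(x)$ of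 dimension $p^2$ that is not associative; here an algebra $A\neq0$ over a field is called a division algebra if left and right multiplication by every nonzero element of $A$ are bijective; 3. $A$ is a nonassociative cyclic extension of $K(x)$ of degree $p$: it is a division algebra that contains $K(x)$, it has dimension $p$ as a left $K(x)$-vector space, and its group of $F(x)$-algebra automorphisms contains a cyclic subgroup of order $p$ which leaves $K(x)$ elementwise fixed. -/

import Mathlib

open Polynomial

noncomputable section

namespace PetitExt

/-! ### Derivations: constants, minimum polynomial, extension to rational functions -/

section Derivations

variable {K : Type*} [Field K]

/-- Derivations `δ : K → K` of a field (additive maps with `δ (a b) = a δ b + b δ a`). -/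
abbrev Der (K : Type*) [Field K] := Derivation ℤ K K

/-- A derivation from an additive map satisfying the Leibniz rule. -/
def Der.ofLeibniz (φ : K → K) (hadd : ∀ a b, φ (a + b) = φ a + φ b)
    (hmul : ∀ a b, φ (a * b) = a * φ b + b * φ a) : Der K :=
  Derivation.mk' (AddMonoidHom.toIntLinearMap (AddMonoidHom.mk' φ hadd)) hmul

/-- The field of constants `Const(δ) = {a | δ a = 0}` of a derivation of a field. -/
def constField (δ : Der K) : Subfield K where
  carrier := {a | δ a = 0}
  mul_mem' {a b} ha hb := by
    simp only [Set.mem_ofPred_eq] at *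
    simp [ha, hb]
  one_mem' := by simp
  add_mem' {a b} ha hb := by
    simp only [Set.mem_ofPred_eq] at *
    simp [ha, hb]
  zero_mem' := by simp
  neg_mem' {a} ha := by
    simp only [Set.mem_ofPred_eq] at *
    simp [ha]
  inv_mem' a ha := by
    simp only [Set.mem_ofPred_eq] at *
    simp [Derivation.leibniz_inv, ha]

/-- A derivation as an endomorphism of the vector space `K` over its field of constants.
The minimum polynomial of `δ` is `minpoly (constField δ) (constEnd δ)`. -/
def constEnd (δ : Der K) : Module.End (constField δ) K where
  toFun := δ
  map_add' := map_add δ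
  map_smul' c a := by
    have hc : δ (c : K) = 0 := c.2
    change δ ((c : K) * a) = (c : K) * δ a
    simp [hc]

/-- The derivation of `K[x]` acting as `δ` on each coefficient (so `x ↦ 0`). -/
def coeffDer (δ : Der K) : Derivation ℤ K[X] K[X] :=
  PolynomialModule.equivPolynomialSelf.compDer δ.mapCoeffs

@[simp]
theorem coeff_coeffDer (δ : Der K) (f : K[X]) (n : ℕ) :
    (coeffDer δ f).coeff n = δ (f.coeff n) := rfl

theorem coeffDer_C (δ : Der K) (a : K) : coeffDer δ (C a) = C (δ a) := by
  ext n
  simp [coeff_C, apply_ite δ]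

theorem coeffDer_X (δ : Der K) : coeffDer δ X = 0 := by
  ext n
  simp [coeff_X, apply_ite δ]

/-- The quotient rule, on the reduced representation of a rational function. -/
def quotRule (δ : Der K) (r : RatFunc K) : RatFunc K :=
  (algebraMap K[X] (RatFunc K) (coeffDer δ r.num) * algebraMap K[X] (RatFunc K) r.denom
    - algebraMap K[X] (RatFunc K) r.num * algebraMap K[X] (RatFunc K) (coeffDer δ r.denom))
    / algebraMap K[X] (RatFunc K) r.denom ^ 2

theorem quotRule_div (δ : Der K) (f g : K[X]) (hg : g ≠ 0) :
    quotRule δ (algebraMap K[X] (RatFunc K) f / algebraMap K[X] (RatFunc K) g) =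
      (algebraMap K[X] (RatFunc K) (coeffDer δ f) * algebraMap K[X] (RatFunc K) g
        - algebraMap K[X] (RatFunc K) f * algebraMap K[X] (RatFunc K) (coeffDer δ g))
        / algebraMap K[X] (RatFunc K) g ^ 2 := by
  generalize hr : algebraMap K[X] (RatFunc K) f / algebraMap K[X] (RatFunc K) g = r
  have key : r.num * g = f * r.denom := (RatFunc.num_mul_eq_mul_denom_iff hg).2 hr.symm
  have hg' : algebraMap K[X] (RatFunc K) g ≠ 0 := RatFunc.algebraMap_ne_zero hg
  have hd' : algebraMap K[X] (RatFunc K) r.denom ≠ 0 :=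
    RatFunc.algebraMap_ne_zero (RatFunc.denom_ne_zero r)
  have e1 := congrArg (algebraMap K[X] (RatFunc K)) key
  have e2 := congrArg (fun q => algebraMap K[X] (RatFunc K) (coeffDer δ q)) key
  simp only [Derivation.leibniz, smul_eq_mul, map_mul, map_add] at e1 e2
  unfold quotRule
  rw [div_eq_div_iff (pow_ne_zero 2 hd') (pow_ne_zero 2 hg')]
  linear_combination (algebraMap K[X] (RatFunc K) r.denom * algebraMap K[X] (RatFunc K) g) * e2
    - (algebraMap K[X] (RatFunc K) g * algebraMap K[X] (RatFunc K) (coeffDer δ r.denom)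
      + algebraMap K[X] (RatFunc K) r.denom * algebraMap K[X] (RatFunc K) (coeffDer δ g)) * e1

/-- The extension of `δ` to `K(x)` with `δ x = 0`: coefficientwise on polynomials, and by the
quotient rule on fractions. -/
def ratDer (δ : Der K) : Der (RatFunc K) :=
  Der.ofLeibniz (quotRule δ)
    (by
      intro r s
      induction r using RatFunc.induction_on with | _ a b hb
      induction s using RatFunc.induction_on with | _ c d hd
      have hb' : algebraMap K[X] (RatFunc K) b ≠ 0 := RatFunc.algebraMap_ne_zero hb
      have hd' : algebraMap K[X] (RatFunc K) d ≠ 0 := RatFunc.algebraMap_ne_zero hd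
      rw [div_add_div _ _ hb' hd', ← map_mul, ← map_mul, ← map_mul, ← map_add,
        quotRule_div δ _ _ (mul_ne_zero hb hd), quotRule_div δ _ _ hb, quotRule_div δ _ _ hd]
      simp only [Derivation.leibniz, smul_eq_mul, map_mul, map_add]
      field_simp
      ring)
    (by
      intro r s
      induction r using RatFunc.induction_on with | _ a b hb
      induction s using RatFunc.induction_on with | _ c d hd
      have hb' : algebraMap K[X] (RatFunc K) b ≠ 0 := RatFunc.algebraMap_ne_zero hb
      have hd' : algebraMap K[X] (RatFunc K) d ≠ 0 := RatFunc.algebraMap_ne_zero hd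
      rw [div_mul_div_comm, ← map_mul, ← map_mul,
        quotRule_div δ _ _ (mul_ne_zero hb hd), quotRule_div δ _ _ hb, quotRule_div δ _ _ hd]
      simp only [Derivation.leibniz, smul_eq_mul, map_mul, map_add]
      field_simp
      ring)

theorem ratDer_algebraMap (δ : Der K) (f : K[X]) :
    ratDer δ (algebraMap K[X] (RatFunc K) f) = algebraMap K[X] (RatFunc K) (coeffDer δ f) := by
  have h := quotRule_div δ f 1 one_ne_zero
  simp only [map_one, div_one, Derivation.map_one_eq_zero, map_zero, mul_zero, sub_zero,
    mul_one, one_pow] at h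
  exact h

/-- `ratDer δ` extends `δ`. -/
theorem ratDer_C (δ : Der K) (a : K) :
    ratDer δ (RatFunc.C a) = RatFunc.C (δ a) := by
  rw [← RatFunc.algebraMap_C, ratDer_algebraMap, coeffDer_C, RatFunc.algebraMap_C]

/-- `ratDer δ` annihilates the indeterminate. -/
theorem ratDer_X (δ : Der K) : ratDer δ RatFunc.X = 0 := by
  rw [← RatFunc.algebraMap_X, ratDer_algebraMap, coeffDer_X, map_zero]

/-- For a subfield `F` of `K`, the field `F(x)` inside `K(x)`: the rational functions with
coefficients in `F`. -/
def ratSubfield (F : Subfield K) : Subfield (RatFunc K) :=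
  (RatFunc.mapRingHom (Polynomial.mapRingHom F.subtype)
    (nonZeroDivisors_le_comap_nonZeroDivisors_of_injective _
      (Polynomial.map_injective F.subtype F.subtype.injective))).fieldRange

end Derivations

/-! ### The differential polynomial ring -/

section DiffPoly

variable {K : Type*} [Field K]

/-- Left multiplication by `t` in `K[t;δ]`, on polynomials `∑ aᵢ tⁱ` with coefficients written on
the left: `t (∑ aᵢ tⁱ) = ∑ aᵢ tⁱ⁺¹ + ∑ δ(aᵢ) tⁱ`. -/
def tMul (δ : Der K) : AddMonoid.End K[X] :=
  AddMonoidHom.mulLeft X + (coeffDer δ : K[X] →ₗ[ℤ] K[X]).toAddMonoidHom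

/-- Left multiplication by a scalar. -/
def cMul (a : K) : AddMonoid.End K[X] := AddMonoidHom.mulLeft (C a)

/-- Left multiplication by `∑ aᵢ tⁱ` in `K[t;δ]`. -/
def lMul (δ : Der K) (f : K[X]) : AddMonoid.End K[X] :=
  f.sum fun i a => cMul a * tMul δ ^ i

theorem end_mul_apply (e e' : AddMonoid.End K[X]) (g : K[X]) : (e * e') g = e (e' g) := rfl

theorem end_add_apply (e e' : AddMonoid.End K[X]) (g : K[X]) : (e + e') g = e g + e' g := rfl

theorem tMul_apply (δ : Der K) (g : K[X]) : tMul δ g = X * g + coeffDer δ g := rfl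

theorem cMul_apply (a : K) (g : K[X]) : cMul a g = C a * g := rfl

theorem cMul_zero : cMul (0 : K) = 0 := by
  ext1 g
  simp [cMul_apply]

theorem cMul_add (a b : K) : cMul (a + b) = cMul a + cMul b := by
  ext1 g
  simp only [cMul_apply, end_add_apply, C_add, add_mul]

theorem cMul_mul (a b : K) : cMul (a * b) = cMul a * cMul b := by
  ext1 g
  simp [cMul_apply, mul_assoc]

/-- The commutation rule `t a = a t + δ(a)`. -/
theorem tMul_mul_cMul (δ : Der K) (a : K) :
    tMul δ * cMul a = cMul a * tMul δ + cMul (δ a) := by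
  ext1 g
  simp only [end_mul_apply, end_add_apply, tMul_apply, cMul_apply,
    Derivation.leibniz, coeffDer_C, smul_eq_mul]
  ring

theorem lMul_monomial (δ : Der K) (i : ℕ) (a : K) :
    lMul δ (monomial i a) = cMul a * tMul δ ^ i := by
  unfold lMul
  rw [Polynomial.sum_monomial_index]
  rw [cMul_zero, zero_mul]

theorem lMul_add (δ : Der K) (f g : K[X]) :
    lMul δ (f + g) = lMul δ f + lMul δ g := by
  unfold lMul
  rw [Polynomial.sum_add_index]
  · intro i
    rw [cMul_zero, zero_mul]
  · intro i a b
    rw [cMul_add, add_mul]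

theorem lMul_cMul (δ : Der K) (a : K) (g : K[X]) :
    lMul δ (cMul a g) = cMul a * lMul δ g := by
  induction g using Polynomial.induction_on' with
  | add p q hp hq => rw [map_add, lMul_add, hp, hq, lMul_add, mul_add]
  | monomial n b =>
    rw [cMul_apply, C_mul_monomial, lMul_monomial, lMul_monomial, cMul_mul, mul_assoc]

theorem coeffDer_monomial (δ : Der K) (n : ℕ) (a : K) :
    coeffDer δ (monomial n a) = monomial n (δ a) := by
  ext m
  simp [coeff_monomial, apply_ite δ]

theorem lMul_tMul (δ : Der K) (g : K[X]) :
    lMul δ (tMul δ g) = tMul δ * lMul δ g := by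
  induction g using Polynomial.induction_on' with
  | add p q hp hq => rw [map_add, lMul_add, hp, hq, lMul_add, mul_add]
  | monomial n b =>
    rw [tMul_apply, X_mul_monomial, coeffDer_monomial, lMul_add, lMul_monomial, lMul_monomial,
      lMul_monomial, ← mul_assoc, tMul_mul_cMul, add_mul, mul_assoc, ← pow_succ']

theorem lMul_tMul_pow (δ : Der K) (i : ℕ) (g : K[X]) :
    lMul δ ((tMul δ ^ i) g) = tMul δ ^ i * lMul δ g := by
  induction i with
  | zero => simp
  | succ n ih => rw [pow_succ', end_mul_apply, lMul_tMul, ih, mul_assoc]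

theorem lMul_lMul (δ : Der K) (f g : K[X]) :
    lMul δ (lMul δ f g) = lMul δ f * lMul δ g := by
  induction f using Polynomial.induction_on' with
  | add p q hp hq => rw [lMul_add, end_add_apply, lMul_add, hp, hq, add_mul]
  | monomial n b =>
    rw [lMul_monomial, end_mul_apply, lMul_cMul, lMul_tMul_pow, mul_assoc]

theorem tMul_pow_one (δ : Der K) (i : ℕ) : (tMul δ ^ i) (1 : K[X]) = X ^ i := by
  induction i with
  | zero => simp
  | succ n ih =>
    rw [pow_succ', end_mul_apply, ih, tMul_apply, Derivation.leibniz_pow, coeffDer_X]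
    simp [pow_succ']

theorem lMul_one (δ : Der K) (f : K[X]) : lMul δ f 1 = f := by
  induction f using Polynomial.induction_on' with
  | add p q hp hq => rw [lMul_add, end_add_apply, hp, hq]
  | monomial n b =>
    rw [lMul_monomial, end_mul_apply, tMul_pow_one, cMul_apply, C_mul_X_pow_eq_monomial]

theorem one_lMul (δ : Der K) : lMul δ 1 = 1 := by
  rw [← C_1, ← monomial_zero_left, lMul_monomial]
  ext1 g
  simp [cMul_apply]

/-- The differential polynomial ring `K[t;δ]`: its elements are the polynomials `∑ aᵢ tⁱ` (stored as
ordinary polynomials with the coefficients on the left), multiplied by the rule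
`t a = a t + δ(a)`. -/
def DiffPoly (_δ : Der K) : Type _ := K[X]

namespace DiffPoly

variable {δ : Der K}

instance : AddCommGroup (DiffPoly δ) := inferInstanceAs (AddCommGroup K[X])

instance : Module K (DiffPoly δ) := inferInstanceAs (Module K K[X])

/-- The underlying coefficient sequence, as an ordinary polynomial (additive data only). -/
def toPoly : DiffPoly δ ≃ₗ[K] K[X] := LinearEquiv.refl K K[X]

instance : Mul (DiffPoly δ) := ⟨fun f g => toPoly.symm (lMul δ (toPoly f) (toPoly g))⟩

instance : One (DiffPoly δ) := ⟨toPoly.symm 1⟩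

theorem toPoly_mul (f g : DiffPoly δ) : toPoly (f * g) = lMul δ (toPoly f) (toPoly g) := rfl

theorem toPoly_one : toPoly (1 : DiffPoly δ) = 1 := rfl

instance : Ring (DiffPoly δ) :=
  { (inferInstance : AddCommGroup (DiffPoly δ)),
    (inferInstance : Mul (DiffPoly δ)), (inferInstance : One (DiffPoly δ)) with
    left_distrib := fun f g h => map_add (lMul δ (toPoly f)) (toPoly g) (toPoly h)
    right_distrib := fun f g h =>
      congrArg (fun e => e (toPoly h)) (lMul_add δ (toPoly f) (toPoly g))
    zero_mul := fun f => by
      apply toPoly.injective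
      rw [toPoly_mul, map_zero]
      simp [lMul]
    mul_zero := fun f => map_zero (lMul δ (toPoly f))
    mul_assoc := fun f g h =>
      congrArg (fun e => e (toPoly h)) (lMul_lMul δ (toPoly f) (toPoly g))
    one_mul := fun f => congrArg (fun e => e (toPoly f)) (one_lMul δ)
    mul_one := fun f => lMul_one δ (toPoly f) }

/-- The scalars of `K[t;δ]`. -/
def scal (δ : Der K) (a : K) : DiffPoly δ := toPoly.symm (C a)

/-- The variable of `K[t;δ]`. -/
def t (δ : Der K) : DiffPoly δ := toPoly.symm X

/-- The degree of a differential polynomial (`⊥` for `0`). -/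
def degree (f : DiffPoly δ) : WithBot ℕ := (toPoly f).degree

theorem scal_mul (a : K) (f : DiffPoly δ) : scal δ a * f = a • f := by
  apply toPoly.injective
  rw [toPoly_mul, map_smul]
  change lMul δ (C a) _ = _
  rw [← monomial_zero_left, lMul_monomial, smul_eq_C_mul]
  simp [cMul_apply]

/-- The defining relation `t a = a t + δ(a)`. -/
theorem t_mul_scal (a : K) : t δ * scal δ a = scal δ a * t δ + scal δ (δ a) := by
  rw [scal_mul]
  apply toPoly.injective
  rw [toPoly_mul, map_add, map_smul]
  change lMul δ X (C a) = a • X + C (δ a)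
  rw [← monomial_one_one_eq_X, lMul_monomial]
  simp [end_mul_apply, cMul_apply, tMul_apply, coeffDer_C, smul_eq_C_mul,
    monomial_one_one_eq_X, X_mul_C]

instance : IsScalarTower K (DiffPoly δ) (DiffPoly δ) where
  smul_assoc a f g := by
    rw [smul_eq_mul, smul_eq_mul, ← scal_mul, ← scal_mul, mul_assoc]

theorem toPoly_eq_zero_iff (f : DiffPoly δ) : toPoly f = 0 ↔ f = 0 :=
  LinearEquiv.map_eq_zero_iff toPoly

theorem degree_coeffDer_le (g : K[X]) : (coeffDer δ g).degree ≤ g.degree := by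
  rw [degree_le_iff_coeff_zero]
  intro m hm
  rw [coeff_coeffDer, coeff_eq_zero_of_degree_lt hm, map_zero]

theorem tMul_top (g : K[X]) (hg : g ≠ 0) :
    (tMul δ g).degree = g.degree + 1 ∧ (tMul δ g).leadingCoeff = g.leadingCoeff := by
  have h1 : (X * g).degree = g.degree + 1 := by rw [degree_mul, degree_X, add_comm]
  have h2 : (coeffDer δ g).degree < (X * g).degree := by
    refine lt_of_le_of_lt (degree_coeffDer_le g) ?_
    rw [h1, degree_eq_natDegree hg]
    exact_mod_cast Nat.lt_succ_self _
  rw [tMul_apply]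
  refine ⟨by rw [degree_add_eq_left_of_degree_lt h2, h1], ?_⟩
  rw [leadingCoeff_add_of_degree_lt' h2, leadingCoeff_mul, leadingCoeff_X, one_mul]

theorem tMul_pow_top (g : K[X]) (hg : g ≠ 0) (n : ℕ) :
    ((tMul δ ^ n) g).degree = g.degree + n ∧ ((tMul δ ^ n) g).leadingCoeff = g.leadingCoeff := by
  induction n with
  | zero => simp
  | succ n ih =>
    have h0 : (tMul δ ^ n) g ≠ 0 := by
      rw [← leadingCoeff_ne_zero, ih.2]
      exact leadingCoeff_ne_zero.2 hg
    rw [pow_succ', end_mul_apply]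
    refine ⟨?_, by rw [(tMul_top _ h0).2, ih.2]⟩
    rw [(tMul_top _ h0).1, ih.1, add_assoc]
    push_cast
    rfl

theorem degree_lMul (f : K[X]) (hf : f ≠ 0) (q : K[X]) :
    (lMul δ q f).degree = q.degree + f.degree := by
  induction hn : q.natDegree using Nat.strong_induction_on generalizing q with
  | _ n ih =>
  by_cases hq : q = 0
  · subst hq
    simp [lMul]
  have hlc : q.leadingCoeff ≠ 0 := leadingCoeff_ne_zero.2 hq
  have htop : (C q.leadingCoeff * (tMul δ ^ q.natDegree) f).degree = q.degree + f.degree := by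
    rw [degree_C_mul hlc, (tMul_pow_top f hf _).1, degree_eq_natDegree hq, add_comm]
  have hdec : lMul δ q f =
      lMul δ q.eraseLead f + C q.leadingCoeff * (tMul δ ^ q.natDegree) f := by
    conv_lhs => rw [← eraseLead_add_monomial_natDegree_leadingCoeff q]
    rw [lMul_add, lMul_monomial]
    rfl
  rw [hdec, degree_add_eq_right_of_degree_lt, htop]
  rw [htop]
  by_cases he : q.eraseLead = 0
  · have h0 : lMul δ (0 : K[X]) f = 0 := by simp [lMul]
    rw [he, h0, degree_zero, degree_eq_natDegree hq, degree_eq_natDegree hf]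
    exact WithBot.bot_lt_coe (q.natDegree + f.natDegree)
  · have hlt : q.eraseLead.degree < q.degree := degree_eraseLead_lt hq
    have hnat : q.eraseLead.natDegree < n := hn ▸ natDegree_lt_natDegree he hlt
    rw [ih _ hnat _ rfl, degree_eq_natDegree hq, degree_eq_natDegree hf, degree_eq_natDegree he]
    rw [degree_eq_natDegree hq, degree_eq_natDegree he] at hlt
    exact_mod_cast Nat.add_lt_add_right (by exact_mod_cast hlt) _

/-- Degrees add in `K[t;δ]`. -/
theorem degree_mul (f g : DiffPoly δ) : (f * g).degree = f.degree + g.degree := by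
  by_cases hg : g = 0
  · subst hg
    simp [degree]
  · exact degree_lMul _ (mt (toPoly_eq_zero_iff g).1 hg) _

/-- Existence in the right division algorithm `g = q f + r`. -/
theorem exists_rightDiv (f : DiffPoly δ) (hf : f ≠ 0) (g : DiffPoly δ) :
    ∃ r : DiffPoly δ, r.degree < f.degree ∧ ∃ q : DiffPoly δ, g = q * f + r := by
  have hf' : toPoly f ≠ 0 := mt (toPoly_eq_zero_iff f).1 hf
  induction hn : g.degree using WellFoundedLT.induction generalizing g with
  | _ n ih =>
  by_cases hlt : g.degree < f.degree
  · exact ⟨g, hlt, 0, by rw [zero_mul, zero_add]⟩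
  have hle : f.degree ≤ g.degree := not_lt.1 hlt
  have hg' : toPoly g ≠ 0 := by
    intro h0
    rw [degree, degree, h0, degree_zero, le_bot_iff, degree_eq_bot] at hle
    exact hf' hle
  have hnat : (toPoly f).natDegree ≤ (toPoly g).natDegree := natDegree_le_natDegree hle
  have hlf : (toPoly f).leadingCoeff ≠ 0 := leadingCoeff_ne_zero.2 hf'
  have hlg : (toPoly g).leadingCoeff ≠ 0 := leadingCoeff_ne_zero.2 hg'
  set c : K := (toPoly g).leadingCoeff / (toPoly f).leadingCoeff with hc
  have hc0 : c ≠ 0 := div_ne_zero hlg hlf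
  set m : ℕ := (toPoly g).natDegree - (toPoly f).natDegree with hm
  set u : DiffPoly δ := toPoly.symm (monomial m c) with hu
  have huf : toPoly (u * f) = C c * (tMul δ ^ m) (toPoly f) := by
    rw [toPoly_mul, hu, LinearEquiv.apply_symm_apply, lMul_monomial]
    rfl
  have hdeg : (toPoly g).degree = (toPoly (u * f)).degree := by
    rw [huf, degree_C_mul hc0, (tMul_pow_top _ hf' _).1, degree_eq_natDegree hf',
      degree_eq_natDegree hg', hm]
    exact_mod_cast (Nat.add_sub_cancel' hnat).symm
  have hlead : (toPoly g).leadingCoeff = (toPoly (u * f)).leadingCoeff := by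
    rw [huf, leadingCoeff_mul, leadingCoeff_C, (tMul_pow_top _ hf' _).2, hc,
      div_mul_cancel₀ _ hlf]
  have hred : (g - u * f).degree < n := by
    rw [← hn, degree, map_sub]
    exact degree_sub_lt_left hdeg hg' hlead
  obtain ⟨r, hr, q, hq⟩ := ih _ hred (g - u * f) rfl
  refine ⟨r, hr, u + q, ?_⟩
  rw [add_mul, add_assoc, ← hq]
  abel

/-- Uniqueness in the right division algorithm. -/
theorem rightDiv_unique (f : DiffPoly δ) {q q' r r' : DiffPoly δ} (hr : r.degree < f.degree)
    (hr' : r'.degree < f.degree) (h : q * f + r = q' * f + r') : r = r' := by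
  have h1 : (q - q') * f = r' - r := by
    rw [sub_mul, sub_eq_sub_iff_add_eq_add, h, add_comm]
  have h2 : (r' - r).degree < f.degree := by
    rw [degree, map_sub]
    exact lt_of_le_of_lt (degree_sub_le _ _) (max_lt hr' hr)
  have h3 : q - q' = 0 := by
    by_contra hne
    have hne' : toPoly (q - q') ≠ 0 := mt (toPoly_eq_zero_iff _).1 hne
    rw [← h1, degree_mul] at h2
    have h4 : (0 : WithBot ℕ) ≤ (q - q').degree := zero_le_degree_iff.2 hne'
    exact absurd h2 (not_lt.2 (le_add_of_nonneg_left h4))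
  rw [h3, zero_mul] at h1
  exact (sub_eq_zero.1 h1.symm).symm

open Classical in
/-- The remainder `g mod_r f` of right division by `f`: the unique `r` with `deg r < deg f` and
`g = q f + r` for some `q` (and `0` if `f = 0`). -/
def modR (f g : DiffPoly δ) : DiffPoly δ :=
  if h : ∃ r : DiffPoly δ, r.degree < f.degree ∧ ∃ q : DiffPoly δ, g = q * f + r
  then h.choose else 0

theorem modR_zero_left (g : DiffPoly δ) : modR 0 g = 0 := by
  unfold modR
  rw [dif_neg]
  rintro ⟨r, hr, -⟩
  rw [degree, degree, map_zero, degree_zero] at hr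
  exact not_lt_bot hr

theorem modR_spec (f : DiffPoly δ) (hf : f ≠ 0) (g : DiffPoly δ) :
    (modR f g).degree < f.degree ∧ ∃ q : DiffPoly δ, g = q * f + modR f g := by
  have h := exists_rightDiv f hf g
  unfold modR
  rw [dif_pos h]
  exact h.choose_spec

theorem modR_eq (f : DiffPoly δ) {g q r : DiffPoly δ} (hr : r.degree < f.degree)
    (h : g = q * f + r) : modR f g = r := by
  have hf : f ≠ 0 := by
    rintro rfl
    rw [degree, degree, map_zero, degree_zero] at hr
    exact not_lt_bot hr
  obtain ⟨h1, q', h2⟩ := modR_spec f hf g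
  exact rightDiv_unique f h1 hr (h2.symm.trans h)

theorem modR_add (f g h : DiffPoly δ) : modR f (g + h) = modR f g + modR f h := by
  by_cases hf : f = 0
  · subst hf
    simp only [modR_zero_left, add_zero]
  obtain ⟨h1, q, h2⟩ := modR_spec f hf g
  obtain ⟨h3, q', h4⟩ := modR_spec f hf h
  refine modR_eq f (q := q + q') ?_ ?_
  · rw [degree, map_add]
    exact lt_of_le_of_lt (degree_add_le _ _) (max_lt h1 h3)
  · conv_lhs => rw [h2, h4]
    rw [add_mul]
    abel

theorem modR_smul (f : DiffPoly δ) (c : K) (g : DiffPoly δ) :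
    modR f (c • g) = c • modR f g := by
  by_cases hf : f = 0
  · subst hf
    simp only [modR_zero_left, smul_zero]
  obtain ⟨h1, q, h2⟩ := modR_spec f hf g
  refine modR_eq f (q := c • q) ?_ ?_
  · rw [degree, map_smul]
    exact lt_of_le_of_lt (degree_smul_le _ _) h1
  · conv_lhs => rw [h2]
    rw [smul_add, smul_mul_assoc]

theorem modR_of_degree_lt (f : DiffPoly δ) {g : DiffPoly δ} (hg : g.degree < f.degree) :
    modR f g = g :=
  modR_eq f (q := 0) hg (by rw [zero_mul, zero_add])

/-- The space `R_m = {g | deg g < m}`, where `m = deg f`. -/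
def remainders (f : DiffPoly δ) : Submodule K (DiffPoly δ) :=
  (degreeLT K (toPoly f).natDegree).comap (toPoly : DiffPoly δ ≃ₗ[K] K[X]).toLinearMap

theorem mem_remainders (f : DiffPoly δ) (hf : f ≠ 0) (g : DiffPoly δ) :
    g ∈ remainders f ↔ g.degree < f.degree := by
  rw [remainders, Submodule.mem_comap, mem_degreeLT, degree, degree,
    degree_eq_natDegree (mt (toPoly_eq_zero_iff f).1 hf)]
  rfl

theorem modR_mem (f g : DiffPoly δ) : modR f g ∈ remainders f := by
  by_cases hf : f = 0
  · subst hf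
    rw [modR_zero_left]
    exact Submodule.zero_mem _
  · exact (mem_remainders f hf _).2 (modR_spec f hf g).1

theorem modR_of_mem (f : DiffPoly δ) {g : DiffPoly δ} (hg : g ∈ remainders f) :
    modR f g = g := by
  by_cases hf : f = 0
  · subst hf
    rw [modR_zero_left, eq_comm, ← toPoly_eq_zero_iff]
    rw [remainders, Submodule.mem_comap, mem_degreeLT, map_zero, natDegree_zero,
      Nat.cast_zero, ← not_le, zero_le_degree_iff, not_not] at hg
    exact hg
  · exact modR_of_degree_lt f ((mem_remainders f hf g).1 hg)

theorem modR_one_mul (f : DiffPoly δ) (g : DiffPoly δ) (hg : g ∈ remainders f) :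
    modR f (modR f 1 * g) = g := by
  by_cases h1 : (1 : DiffPoly δ).degree < f.degree
  · rw [modR_of_degree_lt f h1, one_mul, modR_of_mem f hg]
  · have h0 : ∀ x ∈ remainders f, x = 0 := by
      intro x hx
      rw [remainders, Submodule.mem_comap, mem_degreeLT] at hx
      have hn : (toPoly f).natDegree = 0 := by
        by_contra hne
        apply h1
        rw [degree, degree, toPoly_one, degree_one]
        exact natDegree_pos_iff_degree_pos.1 (Nat.pos_of_ne_zero hne)
      rw [hn, Nat.cast_zero, ← not_le, zero_le_degree_iff, not_not] at hx
      exact (toPoly_eq_zero_iff x).1 hx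
    rw [h0 _ hg, h0 _ (modR_mem f _)]

theorem modR_mul_one (f : DiffPoly δ) (g : DiffPoly δ) (hg : g ∈ remainders f) :
    modR f (g * modR f 1) = g := by
  by_cases h1 : (1 : DiffPoly δ).degree < f.degree
  · rw [modR_of_degree_lt f h1, mul_one, modR_of_mem f hg]
  · have h2 := modR_one_mul f _ (modR_mem f (g * modR f 1))
    have h3 := modR_one_mul f g hg
    have h0 : modR f (1 : DiffPoly δ) = 0 := by
      have hm := modR_mem f (1 : DiffPoly δ)
      rw [remainders, Submodule.mem_comap, mem_degreeLT] at hm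
      have hn : (toPoly f).natDegree = 0 := by
        by_contra hne
        apply h1
        rw [degree, degree, toPoly_one, degree_one]
        exact natDegree_pos_iff_degree_pos.1 (Nat.pos_of_ne_zero hne)
      rw [hn, Nat.cast_zero, ← not_le, zero_le_degree_iff, not_not] at hm
      exact (toPoly_eq_zero_iff _).1 hm
    rw [← h2, h0, zero_mul]
    rw [h0, zero_mul] at h3
    exact h3

end DiffPoly

end DiffPoly

/-! ### Petit algebras -/

section Petit

variable {K : Type*} [Field K] {δ : Der K}

open DiffPoly

/-- The Petit algebra `S_f = K[t;δ]/K[t;δ]f`: the space `R_m` of differential polynomials of degree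
less than `m = deg f`, with multiplication `g ∘ h = g h mod_r f`. -/
def PetitAlgebra (f : DiffPoly δ) : Type _ := remainders f

namespace PetitAlgebra

variable {f : DiffPoly δ}

instance : AddCommGroup (PetitAlgebra f) := inferInstanceAs (AddCommGroup (remainders f))

/-- The left `K`-vector space structure. -/
instance : Module K (PetitAlgebra f) := inferInstanceAs (Module K (remainders f))

instance : Mul (PetitAlgebra f) := ⟨fun g h => ⟨modR f (g.1 * h.1), modR_mem f _⟩⟩

/-- The unit is the polynomial `1` as soon as `deg f ≥ 1`. -/
instance : One (PetitAlgebra f) := ⟨⟨modR f 1, modR_mem f _⟩⟩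

instance : NonAssocRing (PetitAlgebra f) :=
  { (inferInstance : AddCommGroup (PetitAlgebra f)),
    (inferInstance : Mul (PetitAlgebra f)), (inferInstance : One (PetitAlgebra f)) with
    left_distrib := fun g h k => Subtype.ext <| by
      change modR f (g.1 * (h.1 + k.1)) = modR f (g.1 * h.1) + modR f (g.1 * k.1)
      rw [mul_add, modR_add]
    right_distrib := fun g h k => Subtype.ext <| by
      change modR f ((g.1 + h.1) * k.1) = modR f (g.1 * k.1) + modR f (h.1 * k.1)
      rw [add_mul, modR_add]
    zero_mul := fun g => Subtype.ext <| by
      change modR f (0 * g.1) = 0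
      rw [zero_mul, modR_of_mem f (Submodule.zero_mem _)]
    mul_zero := fun g => Subtype.ext <| by
      change modR f (g.1 * 0) = 0
      rw [mul_zero, modR_of_mem f (Submodule.zero_mem _)]
    one_mul := fun g => Subtype.ext (modR_one_mul f g.1 g.2)
    mul_one := fun g => Subtype.ext (modR_mul_one f g.1 g.2) }

/-- `(a g) ∘ h = a (g ∘ h)` for scalars `a ∈ K`. -/
instance : IsScalarTower K (PetitAlgebra f) (PetitAlgebra f) where
  smul_assoc a g h := Subtype.ext <| by
    change modR f ((a • g.1) * h.1) = a • modR f (g.1 * h.1)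
    rw [smul_mul_assoc, modR_smul]

end PetitAlgebra

/-- The differential polynomial `t^p - t - d` in `K[t;δ]`. -/
def cyclicPoly (p : ℕ) (δ : Der K) (d : K) : DiffPoly δ := t δ ^ p - t δ - scal δ d

/-- The algebra `(K, δ, d) = K[t;δ]/K[t;δ](t^p - t - d)`, for `δ` with minimum polynomial
`t^p - t`. -/
abbrev CyclicExt (p : ℕ) (δ : Der K) (d : K) : Type _ := PetitAlgebra (cyclicPoly p δ d)

end Petit

/-! ### Nonassociative division algebras and cyclic extensions -/

section Division

/-- `A` is a (not necessarily associative) unital division algebra over the field `F`: the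
multiplication is `F`-bilinear, `A ≠ 0`, and left and right multiplications by nonzero elements are
bijective. -/
structure IsDivisionAlgebra (F A : Type*) [Field F] [NonAssocRing A] [Module F A] : Prop where
  smul_mul : ∀ (c : F) (a b : A), (c • a) * b = c • (a * b)
  mul_smul : ∀ (c : F) (a b : A), a * (c • b) = c • (a * b)
  nontrivial : Nontrivial A
  left_bijective : ∀ a : A, a ≠ 0 → Function.Bijective fun b : A => a * b
  right_bijective : ∀ a : A, a ≠ 0 → Function.Bijective fun b : A => b * a

/-- The group `Aut_F(A)` of `F`-linear ring automorphisms of `A`. -/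
def algAut (F A : Type*) [Field F] [NonAssocRing A] [Module F A] : Subgroup (RingAut A) where
  carrier := {σ | ∀ (c : F) (a : A), σ (c • a) = c • σ a}
  mul_mem' {σ τ} hσ hτ c a := by
    change σ (τ (c • a)) = c • σ (τ a)
    rw [hτ c a, hσ c (τ a)]
  one_mem' _ _ := rfl
  inv_mem' {σ} hσ c a := by
    change σ.symm (c • a) = c • σ.symm a
    rw [RingEquiv.symm_apply_eq, hσ c, RingEquiv.apply_symm_apply]

/-- `A` is a nonassociative cyclic extension of degree `p` of the field `K`, as an algebra over
`F`: a division algebra over `F` which contains `K` (through the unital ring homomorphism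
`a ↦ a • 1`, whose left multiplications are the `K`-vector space structure of `A`), which has
dimension `p` over `K`, and whose automorphism group has a cyclic subgroup of order `p` that leaves
`K` elementwise fixed. -/
structure IsNonassocCyclicExtension (p : ℕ) (F K A : Type*) [Field F] [Field K] [NonAssocRing A]
    [Module F A] [Module K A] : Prop where
  division : IsDivisionAlgebra F A
  embed_injective : Function.Injective fun a : K => a • (1 : A)
  embed_mul : ∀ a b : K, (a * b) • (1 : A) = (a • (1 : A)) * (b • (1 : A))
  smul_eq_embed_mul : ∀ (a : K) (y : A), a • y = (a • (1 : A)) * y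
  finrank_eq : Module.finrank K A = p
  exists_cyclic : ∃ H : Subgroup (RingAut A), H ≤ algAut F A ∧ IsCyclic H ∧ Nat.card H = p ∧
    ∀ σ ∈ H, ∀ a : K, σ (a • (1 : A)) = a • (1 : A)

end Division

end PetitExt

end

/-!
Since `t^p - t = ∏ (t - i)` over `i ∈ 𝔽_p`, the minimum polynomial provides `u ≠ 0` with `δ u = u`.
As `u^i` spans the eigenspace of `δ` for the eigenvalue `i`, the powers `u^i` form a basis of the
field over its constants. The same `u` works over `K(x)`, where `δ^p = δ` still holds because every
rational function can be written with a `p`th power, hence a constant, as denominator.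

Let `R = L[t;δ]` with `δ^p = δ`, and let `f = t^p - t - d` with `δ d ≠ 0`. The element `t^p - t` is
central. If `f = a b`, then `b (a b + d) = (a b + d) b` gives `b d = (t^p - t - b a) b`, so `b`
commutes with `d`; the next-to-leading coefficient of `b d - d b` is a nonzero multiple of
`(deg b) δ(d)`, hence `p ∣ deg b` and one of the factors is a unit.

If `g h ∈ R f` with `f` irreducible, `h ∉ R f` and `g ≠ 0`, then `R h + R f = R`, so right
multiplication by `h` maps `R/Rg` onto `R/Rf` and `deg f ≤ deg g`: the algebra `R/Rf` has no zero
divisors, and it is a division algebra because it has finite dimension. If it were associative, then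
`f t ∈ R f`, contradicting `f t = t f + δ(d)`. The substitution `t ↦ t + 1` fixes `f` and induces an
automorphism of `R/Rf` of order `p`.
-/

namespace PetitExt

section EigenvectorsOfDerivations

theorem X_pow_char_sub_X_eq_prod (p : ℕ) [Fact p.Prime] (F : Type*) [Field F] [CharP F p] :
    (X ^ p - X : F[X]) = ∏ i : ZMod p, (X - C (ZMod.castHom (dvd_refl p) F i)) := by
  have hroots : (X ^ p - X : (ZMod p)[X]).roots = Finset.univ.val := by
    simpa only [ZMod.card] using FiniteField.roots_X_pow_card_sub_X (ZMod p)
  have hmonic : (X ^ p - X : (ZMod p)[X]).Monic :=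
    monic_X_pow_sub (degree_X.trans_lt (mod_cast (Fact.out : p.Prime).one_lt))
  have hprod := (GaloisField.splits_zmod_X_pow_sub_X p).eq_prod_roots_of_monic hmonic
  rw [hroots] at hprod
  simpa [Polynomial.map_prod] using
    congrArg (Polynomial.map (ZMod.castHom (dvd_refl p) F)) hprod

theorem ker_aeval_X_sub_C {F V : Type*} [Field F] [AddCommGroup V] [Module F V]
    (φ : Module.End F V) (c : F) : LinearMap.ker (aeval φ (X - C c)) = φ.eigenspace c := by
  rw [Module.End.eigenspace_def, map_sub, aeval_X, aeval_C, Algebra.algebraMap_eq_smul_one]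

theorem ker_aeval_prod_X_sub_C {F V ι : Type*} [Field F] [AddCommGroup V] [Module F V]
    (φ : Module.End F V) {v : ι → F} (hv : v.Injective) (s : Finset ι) :
    LinearMap.ker (aeval φ (∏ i ∈ s, (X - C (v i)))) = ⨆ i ∈ s, φ.eigenspace (v i) := by
  classical
  induction s using Finset.induction_on with
  | empty => simp [Module.End.one_eq_id]
  | insert i s hi ih =>
    have hcop : IsCoprime (X - C (v i)) (∏ j ∈ s, (X - C (v j))) :=
      .prod_right fun j hj => pairwise_coprime_X_sub_C hv (ne_of_mem_of_not_mem hj hi).symm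
    rw [Finset.prod_insert hi, ← sup_ker_aeval_eq_ker_aeval_mul_of_coprime φ hcop, ih,
      Finset.iSup_insert, ker_aeval_X_sub_C]

theorem hasEigenvalue_of_isRoot_minpoly {F V : Type*} [Field F] [AddCommGroup V] [Module F V]
    {φ : Module.End F V} (hφ : IsIntegral F φ) {c : F} (hc : (minpoly F φ).IsRoot c) :
    φ.HasEigenvalue c := by
  intro hbot
  obtain ⟨q, hq⟩ := dvd_iff_isRoot.2 hc
  have hq0 : q ≠ 0 := right_ne_zero_of_mul (hq ▸ minpoly.ne_zero hφ)
  have hker : aeval φ q = 0 := by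
    ext w
    have hw : aeval φ q w ∈ φ.eigenspace c := by
      rw [← ker_aeval_X_sub_C, LinearMap.mem_ker, ← Module.End.mul_apply, ← aeval_mul, ← hq,
        minpoly.aeval, LinearMap.zero_apply]
    exact (Submodule.eq_bot_iff _).1 hbot _ hw
  refine (minpoly.degree_le_of_ne_zero F φ hq0 hker).not_gt ?_
  rw [hq, degree_mul, degree_X_sub_C, degree_eq_natDegree hq0]
  exact_mod_cast lt_one_add q.natDegree

variable {p : ℕ} {L : Type*} [Field L] (δ : Der L)

instance constField_charP [CharP L p] : CharP (constField δ) p :=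
  (RingHom.charP_iff _ (algebraMap (constField δ) L).injective p).2 inferInstance

theorem aeval_constEnd_X_pow_sub_X_eq_zero_iff :
    aeval (constEnd δ) (X ^ p - X : (constField δ)[X]) = 0 ↔ ∀ a, δ^[p] a = δ a := by
  rw [map_sub, map_pow, aeval_X, sub_eq_zero, LinearMap.ext_iff]
  simp only [Module.End.pow_apply]
  rfl

variable {δ}

theorem iterate_eq_of_minpoly (hδ : minpoly (constField δ) (constEnd δ) = X ^ p - X) (a : L) :
    δ^[p] a = δ a :=
  (aeval_constEnd_X_pow_sub_X_eq_zero_iff δ).1 (hδ ▸ minpoly.aeval _ _) a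

theorem der_pow_of_eigenvector {u : L} (hu : δ u = u) (n : ℕ) : δ (u ^ n) = n * u ^ n := by
  rw [Derivation.leibniz_pow, hu]
  cases n with
  | zero => simp
  | succ n => simp [pow_succ]

variable [Fact p.Prime]

theorem exists_eigenvector_of_minpoly
    (hδ : minpoly (constField δ) (constEnd δ) = X ^ p - X) : ∃ u : L, u ≠ 0 ∧ δ u = u := by
  have hint : IsIntegral (constField δ) (constEnd δ) := minpoly.ne_zero_iff.1 <| by
    rw [hδ]
    exact FiniteField.X_pow_card_sub_X_ne_zero _ (Fact.out : p.Prime).one_lt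
  obtain ⟨u, hu⟩ :=
    (hasEigenvalue_of_isRoot_minpoly hint (c := 1) (by simp [hδ])).exists_hasEigenvector
  exact ⟨u, hu.2, hu.apply_eq_smul.trans (one_smul _ u)⟩

variable [CharP L p]

theorem hasEigenvector_pow {u : L} (hu0 : u ≠ 0) (hu : δ u = u) (i : ZMod p) :
    (constEnd δ).HasEigenvector (ZMod.castHom (dvd_refl p) (constField δ) i) (u ^ i.val) := by
  refine ⟨Module.End.mem_eigenspace_iff.2 ?_, pow_ne_zero _ hu0⟩
  have hcast : ((ZMod.castHom (dvd_refl p) (constField δ) i : constField δ) : L) = i.val := by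
    conv_lhs => rw [← ZMod.natCast_zmod_val i, map_natCast]
    rfl
  rw [Subfield.smul_def, hcast]
  exact der_pow_of_eigenvector hu _

theorem eigenspace_constEnd_le_span {c : constField δ} {w : L}
    (hw : (constEnd δ).HasEigenvector c w) :
    (constEnd δ).eigenspace c ≤ Submodule.span (constField δ) {w} := by
  intro b hb
  have hδw : δ w = c * w := hw.apply_eq_smul
  have hδb : δ b = c * b := Module.End.mem_eigenspace_iff.1 hb
  have hconst : δ (b / w) = 0 := by
    rw [Derivation.leibniz_div, hδb, hδw]
    simp only [smul_eq_mul]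
    ring
  exact Submodule.mem_span_singleton.2 ⟨⟨b / w, hconst⟩, div_mul_cancel₀ b hw.2⟩

theorem minpoly_constEnd_eq (hδ : ∀ a, δ^[p] a = δ a) {u : L} (hu0 : u ≠ 0) (hu : δ u = u) :
    minpoly (constField δ) (constEnd δ) = X ^ p - X := by
  have hroot := (aeval_constEnd_X_pow_sub_X_eq_zero_iff δ).2 hδ
  have hmonic : (X ^ p - X : (constField δ)[X]).Monic :=
    monic_X_pow_sub (degree_X.trans_lt (mod_cast (Fact.out : p.Prime).one_lt))
  refine eq_of_monic_of_associated (minpoly.monic ⟨_, hmonic, hroot⟩) hmonic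
    (associated_of_dvd_dvd (minpoly.dvd _ _ hroot) ?_)
  rw [X_pow_char_sub_X_eq_prod]
  refine Finset.prod_dvd_of_coprime
    ((pairwise_coprime_X_sub_C (RingHom.injective _)).set_pairwise _) fun i _ => ?_
  exact dvd_iff_isRoot.2 (Module.End.isRoot_of_hasEigenvalue
    (Module.End.hasEigenvalue_of_hasEigenvector (hasEigenvector_pow hu0 hu i)))

theorem span_pow_eigenvector_eq_top (hδ : ∀ a, δ^[p] a = δ a) {u : L} (hu0 : u ≠ 0)
    (hu : δ u = u) :
    Submodule.span (constField δ) (Set.range fun i : ZMod p => u ^ i.val) = ⊤ := by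
  have htop := ker_aeval_prod_X_sub_C (constEnd δ)
    (ZMod.castHom (dvd_refl p) (constField δ)).injective Finset.univ
  rw [← X_pow_char_sub_X_eq_prod, (aeval_constEnd_X_pow_sub_X_eq_zero_iff δ).2 hδ,
    LinearMap.ker_zero] at htop
  rw [eq_top_iff, htop]
  exact iSup₂_le fun i _ => (eigenspace_constEnd_le_span (hasEigenvector_pow hu0 hu i)).trans
    (Submodule.span_mono (Set.singleton_subset_iff.2 ⟨i, rfl⟩))

theorem finrank_constField (hδ : ∀ a, δ^[p] a = δ a) {u : L} (hu0 : u ≠ 0) (hu : δ u = u) :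
    Module.finrank (constField δ) L = p := by
  have hindep := Module.End.eigenvectors_linearIndependent' (constEnd δ)
    (ZMod.castHom (dvd_refl p) (constField δ)) (RingHom.injective _) _ (hasEigenvector_pow hu0 hu)
  rw [Module.finrank_eq_card_basis
    (Module.Basis.mk hindep (span_pow_eigenvector_eq_top hδ hu0 hu).ge), ZMod.card]

end EigenvectorsOfDerivations

section RationalFunctions

variable {K : Type*} [Field K] (δ : Der K)

theorem exists_eq_div_coeffDer_eq_zero (p : ℕ) [NeZero p] [CharP K p] (r : RatFunc K) :
    ∃ f g : K[X], g ≠ 0 ∧ coeffDer δ g = 0 ∧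
      r = algebraMap K[X] (RatFunc K) f / algebraMap K[X] (RatFunc K) g := by
  induction r using RatFunc.induction_on with | _ a b hb
  -- Expanding the fraction by `b ^ (p - 1)` turns the denominator into a `p`th power.
  refine ⟨a * b ^ (p - 1), b ^ p, pow_ne_zero _ hb, ?_, ?_⟩
  · rw [Derivation.leibniz_pow, ← Nat.cast_smul_eq_nsmul K[X], CharP.cast_eq_zero, zero_smul]
  · have hb' : algebraMap K[X] (RatFunc K) b ≠ 0 := RatFunc.algebraMap_ne_zero hb
    rw [map_mul, map_pow, map_pow, div_eq_div_iff hb' (pow_ne_zero _ hb'), mul_assoc, ← pow_succ,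
      Nat.sub_add_cancel NeZero.one_le]

variable {δ}

theorem der_div_of_const {a c : K} (hc : δ c = 0) : δ (a / c) = δ a / c := by
  rw [div_eq_mul_inv, Derivation.leibniz, Derivation.leibniz_inv, hc, neg_smul, smul_zero,
    neg_zero, smul_zero, zero_add, smul_eq_mul, inv_mul_eq_div]

theorem ratDer_div (f : K[X]) {g : K[X]} (hg : coeffDer δ g = 0) :
    ratDer δ (algebraMap K[X] (RatFunc K) f / algebraMap K[X] (RatFunc K) g) =
      algebraMap K[X] (RatFunc K) (coeffDer δ f) / algebraMap K[X] (RatFunc K) g := by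
  rw [der_div_of_const (by rw [ratDer_algebraMap, hg, map_zero]), ratDer_algebraMap]

theorem ratDer_iterate_eq {p : ℕ} [NeZero p] [CharP K p] (hδ : ∀ a, δ^[p] a = δ a)
    (r : RatFunc K) : (ratDer δ)^[p] r = ratDer δ r := by
  obtain ⟨f, g, -, hg, rfl⟩ := exists_eq_div_coeffDer_eq_zero δ p r
  have hcoeff : (coeffDer δ)^[p] f = coeffDer δ f := by
    ext k
    have hsemi : Function.Semiconj (coeff · k) (coeffDer δ) δ := fun _ => rfl
    exact (hsemi.iterate_right p f).trans (hδ _)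
  have hsemi : Function.Semiconj
      (fun f => algebraMap K[X] (RatFunc K) f / algebraMap K[X] (RatFunc K) g)
      (coeffDer δ) (ratDer δ) := fun f => (ratDer_div f hg).symm
  rw [ratDer_div f hg, ← hcoeff]
  exact (hsemi.iterate_right p f).symm

theorem coeffDer_eq_zero_iff {f : K[X]} :
    coeffDer δ f = 0 ↔ ∃ g : (constField δ)[X], g.map (constField δ).subtype = f := by
  rw [← mem_lifts, lifts_iff_coeff_lifts, Polynomial.ext_iff]
  refine forall_congr' fun n => ?_
  rw [coeff_coeffDer, coeff_zero]
  exact ⟨fun h => ⟨⟨_, h⟩, rfl⟩, fun ⟨c, hc⟩ => hc ▸ c.2⟩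

theorem mem_ratSubfield_iff {F : Subfield K} {r : RatFunc K} :
    r ∈ ratSubfield F ↔ ∃ f g : F[X],
      r = algebraMap K[X] (RatFunc K) (f.map F.subtype) /
        algebraMap K[X] (RatFunc K) (g.map F.subtype) := by
  have hdiv := RatFunc.map_apply_div (Polynomial.mapRingHom F.subtype)
    (nonZeroDivisors_le_comap_nonZeroDivisors_of_injective _
      (Polynomial.map_injective F.subtype F.subtype.injective))
  constructor
  · rintro ⟨s, rfl⟩
    induction s using RatFunc.induction_on with | _ a b
    exact ⟨a, b, hdiv a b⟩
  · rintro ⟨f, g, rfl⟩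
    exact ⟨_, hdiv f g⟩

theorem constField_ratDer (p : ℕ) [NeZero p] [CharP K p] :
    constField (ratDer δ) = ratSubfield (constField δ) := by
  ext r
  rw [mem_ratSubfield_iff]
  constructor
  · intro hr
    obtain ⟨f, g, hg0, hg, rfl⟩ := exists_eq_div_coeffDer_eq_zero δ p r
    have hf : coeffDer δ f = 0 := by
      have h := (ratDer_div f hg).symm.trans hr
      rwa [div_eq_zero_iff, or_iff_left (RatFunc.algebraMap_ne_zero hg0),
        map_eq_zero_iff _ (RatFunc.algebraMap_injective K)] at h
    obtain ⟨f', rfl⟩ := coeffDer_eq_zero_iff.1 hf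
    obtain ⟨g', rfl⟩ := coeffDer_eq_zero_iff.1 hg
    exact ⟨f', g', rfl⟩
  · rintro ⟨f, g, rfl⟩
    refine (ratDer_div _ (coeffDer_eq_zero_iff.2 ⟨g, rfl⟩)).trans ?_
    rw [coeffDer_eq_zero_iff.2 ⟨f, rfl⟩, map_zero, zero_div]

end RationalFunctions

section DifferentialPolynomials

namespace DiffPoly

variable {L : Type*} [Field L] {δ : Der L}

theorem toPoly_scal (a : L) : toPoly (scal δ a) = C a := rfl

theorem scal_zero : scal δ (0 : L) = 0 := toPoly.injective C_0

theorem toPoly_t_mul (g : DiffPoly δ) :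
    toPoly (t δ * g) = X * toPoly g + coeffDer δ (toPoly g) := by
  rw [toPoly_mul, show toPoly (t δ) = monomial 1 1 from monomial_one_one_eq_X.symm, lMul_monomial,
    pow_one, end_mul_apply, tMul_apply, cMul_apply, C_1, one_mul]

theorem toPoly_t_pow (n : ℕ) : toPoly (t δ ^ n) = X ^ n := by
  induction n with
  | zero => rfl
  | succ n ih =>
    rw [pow_succ', toPoly_t_mul, ih, Derivation.leibniz_pow, coeffDer_X, smul_zero, smul_zero,
      add_zero, pow_succ']

theorem t_pow_mem_remainders {f : DiffPoly δ} {k : ℕ} (hk : k < (toPoly f).natDegree) :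
    t δ ^ k ∈ remainders f := by
  rw [remainders, Submodule.mem_comap, mem_degreeLT, LinearEquiv.coe_coe, toPoly_t_pow,
    degree_X_pow]
  exact_mod_cast hk

theorem induction_on {P : DiffPoly δ → Prop} (g : DiffPoly δ)
    (smul_t_pow : ∀ (a : L) (n : ℕ), P (a • t δ ^ n))
    (add : ∀ g h, P g → P h → P (g + h)) : P g := by
  refine Polynomial.induction_on' (motive := fun g => P (toPoly.symm g)) (toPoly g) ?_ ?_
  · intro g h hg hh
    rw [map_add]
    exact add _ _ hg hh
  · intro n a
    rw [← C_mul_X_pow_eq_monomial, ← smul_eq_C_mul, map_smul, ← toPoly_t_pow (δ := δ),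
      LinearEquiv.symm_apply_apply]
    exact smul_t_pow a n

theorem scal_mul_scal (a b : L) : scal δ a * scal δ b = scal δ (a * b) := by
  rw [scal_mul]
  exact toPoly.injective (smul_C a b)

theorem mem_center_of_commute {z : DiffPoly δ} (hscal : ∀ a, Commute z (scal δ a))
    (ht : Commute z (t δ)) : z ∈ Subring.center (DiffPoly δ) := by
  rw [Subring.mem_center_iff]
  intro g
  induction g using induction_on with
  | smul_t_pow a n =>
    rw [← scal_mul]
    exact ((hscal a).mul_right (ht.pow_right n)).eq.symm
  | add g h hg hh => rw [add_mul, mul_add, hg, hh]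

theorem scal_mem_center {c : L} (hc : δ c = 0) : scal δ c ∈ Subring.center (DiffPoly δ) := by
  refine mem_center_of_commute (fun a => ?_) ?_
  · rw [Commute, SemiconjBy, scal_mul_scal, scal_mul_scal, mul_comm]
  · have h := t_mul_scal (δ := δ) c
    rw [hc, scal_zero, add_zero] at h
    exact h.symm

instance : SMulCommClass (constField δ) (DiffPoly δ) (DiffPoly δ) where
  smul_comm c g h := by
    rw [smul_eq_mul, smul_eq_mul, Subfield.smul_def, Subfield.smul_def, ← scal_mul, ← scal_mul,
      ← mul_assoc, ← mul_assoc, Subring.mem_center_iff.1 (scal_mem_center c.2)]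

theorem coeff_t_pow_mul_scal (n : ℕ) (d : L) (k : ℕ) :
    (toPoly (t δ ^ n * scal δ d)).coeff k = n.choose k • δ^[n - k] d := by
  induction n generalizing k with
  | zero => cases k <;> simp [toPoly_scal]
  | succ n ih =>
    rw [pow_succ', mul_assoc, toPoly_t_mul, coeff_add, coeff_coeffDer, ih, map_nsmul,
      ← Function.iterate_succ_apply' δ]
    cases k with
    | zero => simp
    | succ k =>
      rw [coeff_X_mul, ih, Nat.choose_succ_succ, add_smul, Nat.succ_sub_succ]
      rcases lt_or_ge k n with hk | hk
      · rw [show (n - (k + 1)).succ = n - k by omega]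
      · rw [Nat.choose_eq_zero_of_lt (by omega : n < k + 1), zero_smul, zero_smul]

theorem coeff_mul_scal (b : DiffPoly δ) (d : L) (k : ℕ) :
    (toPoly (b * scal δ d)).coeff k =
      (toPoly b).sum fun n a => a * n.choose k • δ^[n - k] d := by
  induction b using induction_on with
  | smul_t_pow a n =>
    rw [smul_mul_assoc, map_smul, coeff_smul, coeff_t_pow_mul_scal, map_smul, toPoly_t_pow,
      smul_X_eq_monomial]
    exact (sum_monomial_index a (fun n a => a * n.choose k • δ^[n - k] d) (zero_mul _)).symm
  | add g h hg hh =>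
    rw [add_mul, map_add, coeff_add, hg, hh, map_add]
    exact (sum_add_index _ _ _ (fun _ => zero_mul _) fun _ _ _ => add_mul _ _ _).symm

theorem coeff_natDegree_mul_scal (b : DiffPoly δ) (d : L) :
    (toPoly (b * scal δ d)).coeff (toPoly b).natDegree = (toPoly b).leadingCoeff * d := by
  rw [coeff_mul_scal, sum_over_range _ fun _ => zero_mul _, Finset.sum_range_succ,
    Finset.sum_eq_zero fun n hn => ?_]
  · simp
  · rw [Nat.choose_eq_zero_of_lt (Finset.mem_range.1 hn), zero_smul, mul_zero]

theorem coeff_mul_scal_of_natDegree_eq {b : DiffPoly δ} {n : ℕ} (hn : (toPoly b).natDegree = n + 1)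
    (d : L) : (toPoly (b * scal δ d)).coeff n =
      (toPoly b).coeff n * d + (toPoly b).leadingCoeff * ((n + 1 : ℕ) * δ d) := by
  rw [coeff_mul_scal, sum_over_range _ fun _ => zero_mul _, hn, Finset.sum_range_succ,
    Finset.sum_range_succ, Finset.sum_eq_zero fun m hm => ?_]
  · simp [leadingCoeff, hn]
  · rw [Nat.choose_eq_zero_of_lt (Finset.mem_range.1 hm), zero_smul, mul_zero]

theorem natDegree_mul_der_eq_zero {b : DiffPoly δ} {d : L} (h : Commute b (scal δ d)) :
    (toPoly b).natDegree * δ d = 0 := by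
  rcases hn : (toPoly b).natDegree with _ | n
  · rw [Nat.cast_zero, zero_mul]
  have hb0 : (toPoly b).leadingCoeff ≠ 0 := by
    rw [leadingCoeff_ne_zero]
    rintro h0
    simp [h0] at hn
  have hcoeff := coeff_mul_scal_of_natDegree_eq hn d
  rw [h.eq, scal_mul, map_smul, coeff_smul, smul_eq_mul, mul_comm, left_eq_add,
    mul_eq_zero, or_iff_right hb0] at hcoeff
  exact hcoeff

theorem degree_eq_bot {f : DiffPoly δ} : f.degree = ⊥ ↔ f = 0 :=
  Polynomial.degree_eq_bot.trans (toPoly_eq_zero_iff f)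

theorem commute_scal_of_mul_scal_eq {b u : DiffPoly δ} {d : L} (h : b * scal δ d = u * b) :
    Commute b (scal δ d) := by
  by_cases hb : b = 0
  · exact hb ▸ Commute.zero_left _
  have hu : u.degree ≤ 0 := by
    have hdeg := congrArg degree h
    rw [degree_mul, degree_mul, add_comm] at hdeg
    exact (WithBot.add_right_cancel (mt degree_eq_bot.1 hb) hdeg).ge.trans degree_C_le
  obtain ⟨e, rfl⟩ : ∃ e, u = scal δ e := ⟨_, toPoly.injective (eq_C_of_degree_le_zero hu)⟩
  have hlead := coeff_natDegree_mul_scal b d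
  rw [h, scal_mul, map_smul, coeff_smul, smul_eq_mul, mul_comm, coeff_natDegree] at hlead
  obtain rfl := mul_left_cancel₀ (leadingCoeff_ne_zero.2 (mt (toPoly_eq_zero_iff b).1 hb)) hlead
  exact h

section CharP

variable {p : ℕ} [Fact p.Prime] [CharP L p]

theorem t_pow_char_mul_scal (a : L) :
    t δ ^ p * scal δ a = scal δ a * t δ ^ p + scal δ (δ^[p] a) := by
  have hp := (Fact.out : p.Prime)
  apply toPoly.injective
  ext k
  rw [coeff_t_pow_mul_scal, scal_mul, map_add, map_smul, toPoly_t_pow, toPoly_scal, coeff_add,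
    coeff_smul, coeff_X_pow, coeff_C, smul_eq_mul]
  rcases eq_or_ne k 0 with rfl | hk0
  · simp [hp.ne_zero.symm]
  rcases eq_or_ne k p with rfl | hkp
  · simp [hk0]
  rcases lt_or_gt_of_ne hkp with hk | hk
  · have hchoose : ((p.choose k : ℕ) : L) = 0 :=
      (CharP.cast_eq_zero_iff L p _).2 (hp.dvd_choose_self hk0 hk)
    simp [hk0, hkp, hchoose]
  · simp [hk0, hkp, Nat.choose_eq_zero_of_lt hk]

theorem t_pow_char_sub_t_mem_center (hδ : ∀ a, δ^[p] a = δ a) :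
    t δ ^ p - t δ ∈ Subring.center (DiffPoly δ) := by
  refine mem_center_of_commute (fun a => ?_) (((Commute.refl _).pow_left p).sub_left (.refl _))
  rw [Commute, SemiconjBy, sub_mul, t_pow_char_mul_scal, t_mul_scal, hδ, add_sub_add_right_eq_sub,
    mul_sub]

end CharP

end DiffPoly

end DifferentialPolynomials

theorem exists_mul_add_mul_eq_one_of_irreducible {R : Type*} [Ring R] [IsPrincipalIdealRing R]
    {f h : R} (hf : Irreducible f) (hh : h ∉ Ideal.span {f}) : ∃ u v, u * h + v * f = 1 := by
  obtain ⟨g, hg⟩ := (IsPrincipalIdealRing.principal (Ideal.span {h, f})).principal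
  have hdvd : ∀ x ∈ ({h, f} : Set R), ∃ a, a * g = x := fun x hx =>
    Ideal.mem_span_singleton'.1 (hg.le (Ideal.subset_span hx))
  obtain ⟨a, hfa⟩ := hdvd f (.inr rfl)
  obtain ⟨b, hhb⟩ := hdvd h (.inl rfl)
  obtain ha | hg' := hf.isUnit_or_isUnit hfa.symm
  · obtain ⟨a, rfl⟩ := ha
    refine absurd (Ideal.mem_span_singleton'.2 ⟨b * ↑a⁻¹, ?_⟩) hh
    rw [← hfa, mul_assoc, Units.inv_mul_cancel_left, hhb]
  · have htop : Ideal.span {h, f} = ⊤ := hg.trans (Ideal.eq_top_of_isUnit_mem _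
      (Ideal.mem_span_singleton_self g) hg')
    exact Ideal.mem_span_pair.1 ((Ideal.eq_top_iff_one _).1 htop)

section DifferentialPolynomials

namespace DiffPoly

variable {L : Type*} [Field L] {δ : Der L}

instance : NoZeroDivisors (DiffPoly δ) where
  eq_zero_or_eq_zero_of_mul_eq_zero {f g} h := by
    rw [← degree_eq_bot, degree_mul, WithBot.add_eq_bot] at h
    exact h.imp degree_eq_bot.1 degree_eq_bot.1

theorem natDegree_mul {f g : DiffPoly δ} (hf : f ≠ 0) (hg : g ≠ 0) :
    (toPoly (f * g)).natDegree = (toPoly f).natDegree + (toPoly g).natDegree := by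
  have h := degree_mul f g
  rw [degree, degree, degree, degree_eq_natDegree (mt (toPoly_eq_zero_iff _).1 (mul_ne_zero hf hg)),
    degree_eq_natDegree (mt (toPoly_eq_zero_iff _).1 hf),
    degree_eq_natDegree (mt (toPoly_eq_zero_iff _).1 hg)] at h
  exact_mod_cast h

theorem eq_scal_of_natDegree_eq_zero {f : DiffPoly δ} (hf : (toPoly f).natDegree = 0) :
    f = scal δ ((toPoly f).coeff 0) :=
  toPoly.injective (eq_C_of_natDegree_eq_zero hf)

theorem isUnit_scal {a : L} (ha : a ≠ 0) : IsUnit (scal δ a) :=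
  ⟨⟨scal δ a, scal δ a⁻¹, by rw [scal_mul_scal, mul_inv_cancel₀ ha]; rfl,
    by rw [scal_mul_scal, inv_mul_cancel₀ ha]; rfl⟩, rfl⟩

theorem isUnit_of_natDegree_eq_zero {f : DiffPoly δ} (hf0 : f ≠ 0)
    (hf : (toPoly f).natDegree = 0) : IsUnit f := by
  rw [eq_scal_of_natDegree_eq_zero hf] at hf0 ⊢
  exact isUnit_scal fun h0 => hf0 (by rw [h0, scal_zero])

theorem natDegree_eq_zero_of_isUnit {f : DiffPoly δ} (hf : IsUnit f) :
    (toPoly f).natDegree = 0 := by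
  obtain ⟨g, hfg⟩ := hf.exists_right_inv
  have hfg0 : f * g ≠ 0 := hfg ▸ (toPoly_eq_zero_iff _).not.1 one_ne_zero
  have h := natDegree_mul (left_ne_zero_of_mul hfg0) (right_ne_zero_of_mul hfg0)
  rw [hfg, toPoly_one, natDegree_one] at h
  omega

instance : IsPrincipalIdealRing (DiffPoly δ) where
  principal I := by
    by_cases hI : I = ⊥
    · exact hI ▸ bot_isPrincipal
    obtain ⟨f, ⟨hfI, hf0⟩, hmin⟩ := WellFounded.has_min (InvImage.wf degree wellFounded_lt)
      {g | g ∈ I ∧ g ≠ 0} (Submodule.exists_mem_ne_zero_of_ne_bot hI)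
    refine ⟨f, le_antisymm (fun g hg => ?_) ((Ideal.span_singleton_le_iff_mem I).2 hfI)⟩
    obtain ⟨r, hr, q, rfl⟩ := exists_rightDiv f hf0 g
    have hrI : r ∈ I := (I.add_mem_iff_right (I.mul_mem_left q hfI)).1 hg
    have hr0 : r = 0 := by
      by_contra hr0
      exact hmin r ⟨hrI, hr0⟩ hr
    rw [hr0, add_zero]
    exact Ideal.mul_mem_left _ q (Ideal.mem_span_singleton_self f)

section CyclicPoly

variable {p : ℕ}

theorem toPoly_cyclicPoly (d : L) : toPoly (cyclicPoly p δ d) = X ^ p - X - C d := by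
  rw [cyclicPoly, map_sub, map_sub, toPoly_t_pow, toPoly_scal]
  rfl

variable [Fact p.Prime]

theorem monic_cyclicPoly (d : L) : (toPoly (cyclicPoly p δ d)).Monic := by
  rw [toPoly_cyclicPoly, sub_sub]
  exact monic_X_pow_sub ((degree_X_add_C d).trans_lt (mod_cast (Fact.out : p.Prime).one_lt))

theorem natDegree_cyclicPoly (d : L) : (toPoly (cyclicPoly p δ d)).natDegree = p := by
  rw [toPoly_cyclicPoly, sub_sub, natDegree_sub_eq_left_of_natDegree_lt, natDegree_X_pow]
  rw [natDegree_X_add_C, natDegree_X_pow]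
  exact (Fact.out : p.Prime).one_lt

theorem one_lt_natDegree_cyclicPoly (d : L) : 1 < (toPoly (cyclicPoly p δ d)).natDegree := by
  rw [natDegree_cyclicPoly]
  exact (Fact.out : p.Prime).one_lt

theorem cyclicPoly_ne_zero (d : L) : cyclicPoly p δ d ≠ 0 :=
  (toPoly_eq_zero_iff _).not.1 (monic_cyclicPoly d).ne_zero

variable [CharP L p]

theorem commute_scal_of_cyclicPoly_eq_mul (hδ : ∀ a, δ^[p] a = δ a) {d : L} {a b : DiffPoly δ}
    (hab : cyclicPoly p δ d = a * b) : Commute b (scal δ d) := by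
  have hz : t δ ^ p - t δ = a * b + scal δ d := sub_eq_iff_eq_add.1 hab
  have hcomm := Subring.mem_center_iff.1 (t_pow_char_sub_t_mem_center hδ) b
  refine commute_scal_of_mul_scal_eq (u := t δ ^ p - t δ - b * a) ?_
  rw [sub_mul, ← hcomm, hz, mul_add, mul_assoc b a b, add_sub_cancel_left]

theorem irreducible_cyclicPoly (hδ : ∀ a, δ^[p] a = δ a) {d : L} (hd : δ d ≠ 0) :
    Irreducible (cyclicPoly p δ d) := by
  have hp := (Fact.out : p.Prime)
  refine ⟨fun hunit => hp.ne_zero ?_, fun a b hab => ?_⟩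
  · exact (natDegree_cyclicPoly d).symm.trans (natDegree_eq_zero_of_isUnit hunit)
  have hab0 : a * b ≠ 0 := hab ▸ cyclicPoly_ne_zero d
  have ha0 := left_ne_zero_of_mul hab0
  have hb0 := right_ne_zero_of_mul hab0
  have hdeg := natDegree_mul ha0 hb0
  rw [← hab, natDegree_cyclicPoly] at hdeg
  obtain ⟨m, hm⟩ : p ∣ (toPoly b).natDegree := by
    have h := natDegree_mul_der_eq_zero (commute_scal_of_cyclicPoly_eq_mul hδ hab)
    rwa [mul_eq_zero, or_iff_left hd, CharP.cast_eq_zero_iff L p] at h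
  rcases Nat.eq_zero_or_pos m with rfl | hm0
  · exact .inr (isUnit_of_natDegree_eq_zero hb0 (by rwa [mul_zero] at hm))
  · have hle : p ≤ (toPoly b).natDegree := hm ▸ Nat.le_mul_of_pos_right p hm0
    exact .inl (isUnit_of_natDegree_eq_zero ha0 (by omega))

theorem cyclicPoly_mul_t (hδ : ∀ a, δ^[p] a = δ a) (d : L) :
    cyclicPoly p δ d * t δ = t δ * cyclicPoly p δ d + scal δ (δ d) := by
  rw [cyclicPoly, sub_mul _ (scal δ d), mul_sub _ _ (scal δ d), t_mul_scal,
    Subring.mem_center_iff.1 (t_pow_char_sub_t_mem_center hδ)]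
  abel

end CyclicPoly

end DiffPoly

end DifferentialPolynomials

section PetitAlgebras

theorem IsDivisionAlgebra.of_noZeroDivisors {F A : Type*} [Field F] [NonAssocRing A] [Module F A]
    [IsScalarTower F A A] [SMulCommClass F A A] [Module.Finite F A] [Nontrivial A]
    [NoZeroDivisors A] : IsDivisionAlgebra F A where
  smul_mul := smul_mul_assoc
  mul_smul := mul_smul_comm
  nontrivial := inferInstance
  left_bijective a ha := by
    have hinj : Function.Injective (LinearMap.mulLeft F a) :=
      (injective_iff_map_eq_zero _).2 fun _ hb => (mul_eq_zero.1 hb).resolve_left ha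
    exact ⟨hinj, LinearMap.surjective_of_injective hinj⟩
  right_bijective a ha := by
    have hinj : Function.Injective (LinearMap.mulRight F a) :=
      (injective_iff_map_eq_zero _).2 fun _ hb => (mul_eq_zero.1 hb).resolve_right ha
    exact ⟨hinj, LinearMap.surjective_of_injective hinj⟩

namespace PetitAlgebra

variable {L : Type*} [Field L] {δ : Der L} {f : DiffPoly δ}

open DiffPoly

/-- The class of a differential polynomial in `R/Rf`, represented by its remainder modulo `f`. -/
noncomputable def mk (f : DiffPoly δ) : DiffPoly δ →ₗ[L] PetitAlgebra f where
  toFun g := ⟨modR f g, modR_mem f g⟩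
  map_add' g h := Subtype.ext (modR_add f g h)
  map_smul' c g := Subtype.ext (modR_smul f c g)

theorem mk_val (a : PetitAlgebra f) : mk f a.1 = a := Subtype.ext (modR_of_mem f a.2)

theorem mk_val_mul_val (a b : PetitAlgebra f) : mk f (a.1 * b.1) = a * b := rfl

theorem mk_eq_zero_iff (hf : f ≠ 0) {g : DiffPoly δ} : mk f g = 0 ↔ g ∈ Ideal.span {f} := by
  rw [Ideal.mem_span_singleton']
  refine (Subtype.ext_iff (p := (· ∈ remainders f))).trans ⟨fun h => ?_, ?_⟩
  · obtain ⟨-, q, hq⟩ := modR_spec f hf g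
    rw [show modR f g = 0 from h, add_zero] at hq
    exact ⟨q, hq.symm⟩
  · rintro ⟨q, rfl⟩
    exact modR_eq f ((mem_remainders f hf 0).1 (zero_mem _)) (add_zero _).symm

theorem mk_eq_mk_iff (hf : f ≠ 0) {g h : DiffPoly δ} :
    mk f g = mk f h ↔ g - h ∈ Ideal.span {f} := by
  rw [← mk_eq_zero_iff hf, map_sub, sub_eq_zero]

theorem val_mk_sub_mem_span (hf : f ≠ 0) (g : DiffPoly δ) : (mk f g).1 - g ∈ Ideal.span {f} :=
  (mk_eq_mk_iff hf).1 (mk_val _)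

theorem mul_assoc_iff (hf : f ≠ 0) (a b c : PetitAlgebra f) :
    a * b * c = a * (b * c) ↔ (a.1 * b.1 - (a * b).1) * c.1 ∈ Ideal.span {f} := by
  have hbc : mk f (a.1 * (b * c).1) = mk f (a.1 * (b.1 * c.1)) := by
    rw [mk_eq_mk_iff hf, ← mul_sub]
    exact Ideal.mul_mem_left _ _ (val_mk_sub_mem_span hf (b.1 * c.1))
  rw [eq_comm, ← mk_val_mul_val a, hbc, ← mk_val_mul_val (a * b), mk_eq_mk_iff hf, sub_mul,
    mul_assoc]

/-- The coordinates of an element of `R/Rf` with respect to `1, t, …, t^(n-1)`, `n = deg f`. -/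
noncomputable def equivFun (f : DiffPoly δ) : PetitAlgebra f ≃ₗ[L]
    (Fin (toPoly f).natDegree → L) :=
  (LinearEquiv.ofSubmodule' (toPoly : DiffPoly δ ≃ₗ[L] L[X]) _).trans (degreeLTEquiv L _)

theorem finrank_eq (f : DiffPoly δ) :
    Module.finrank L (PetitAlgebra f) = (toPoly f).natDegree := by
  rw [(equivFun f).finrank_eq, Module.finrank_fin_fun]

instance : Module.Finite L (PetitAlgebra f) := Module.Finite.equiv (equivFun f).symm

instance : SMulCommClass (constField δ) (PetitAlgebra f) (PetitAlgebra f) where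
  smul_comm c a b := by
    have h := congrArg (mk f) (smul_comm c a.1 b.1)
    exact ((mk f).map_smul (c : L) (a.1 * b.1)).symm.trans h

theorem natDegree_le_of_mul_mem_span (hf : Irreducible f) {g h : DiffPoly δ} (hg : g ≠ 0)
    (hh : h ∉ Ideal.span {f}) (hgh : g * h ∈ Ideal.span {f}) :
    (toPoly f).natDegree ≤ (toPoly g).natDegree := by
  obtain ⟨u, v, huv⟩ := exists_mul_add_mul_eq_one_of_irreducible hf hh
  let φ : PetitAlgebra g →ₗ[L] PetitAlgebra f :=
    mk f ∘ₗ LinearMap.mulRight L h ∘ₗ (remainders g).subtype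
  have hφ : Function.Surjective φ := fun s => by
    obtain ⟨q, hq⟩ := Ideal.mem_span_singleton'.1 (val_mk_sub_mem_span hg (s.1 * u))
    refine ⟨mk g (s.1 * u), Eq.trans ?_ (mk_val s)⟩
    refine (mk_eq_mk_iff hf.ne_zero).2 ?_
    have hs : (mk g (s.1 * u)).1 * h - s.1 = q * (g * h) - s.1 * v * f := by
      rw [← mul_assoc, hq, sub_mul, sub_sub, mul_assoc, mul_assoc, ← mul_add, huv, mul_one]
    exact hs ▸ sub_mem (Ideal.mul_mem_left _ _ hgh)
      (Ideal.mul_mem_left _ _ (Ideal.mem_span_singleton_self f))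
  simpa only [finrank_eq] using LinearMap.finrank_le_finrank_of_surjective hφ

theorem noZeroDivisors (hf : Irreducible f) : NoZeroDivisors (PetitAlgebra f) where
  eq_zero_or_eq_zero_of_mul_eq_zero {a b} hab := by
    by_contra! hne
    have hb : b.1 ∉ Ideal.span {f} := by rw [← mk_eq_zero_iff hf.ne_zero, mk_val]; exact hne.2
    have ha : a.1 ≠ 0 := fun h0 => hne.1 (Subtype.ext h0)
    have hle := natDegree_le_of_mul_mem_span hf ha hb ((mk_eq_zero_iff hf.ne_zero).1 hab)
    have hlt := (mem_remainders f hf.ne_zero _).1 a.2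
    exact hle.not_gt (natDegree_lt_natDegree (mt (toPoly_eq_zero_iff _).1 ha) hlt)

theorem nontrivial (hf : 0 < (toPoly f).natDegree) : Nontrivial (PetitAlgebra f) :=
  Module.nontrivial_of_finrank_pos (R := L) (finrank_eq f ▸ hf)

theorem isDivisionAlgebra (hf : Irreducible f) [Module.Finite (constField δ) L] :
    IsDivisionAlgebra (constField δ) (PetitAlgebra f) := by
  have : Module.Finite (constField δ) (PetitAlgebra f) := .trans L _
  have : NoZeroDivisors (PetitAlgebra f) := noZeroDivisors hf
  have : Nontrivial (PetitAlgebra f) := nontrivial (Nat.pos_of_ne_zero fun h0 =>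
    hf.not_isUnit (isUnit_of_natDegree_eq_zero hf.ne_zero h0))
  exact .of_noZeroDivisors

theorem val_mk_t_pow_natDegree (hf : (toPoly f).Monic) :
    (mk f (t δ ^ (toPoly f).natDegree)).1 = t δ ^ (toPoly f).natDegree - f := by
  refine modR_eq f (q := 1) ?_ (by rw [one_mul, add_sub_cancel])
  rw [DiffPoly.degree, DiffPoly.degree, map_sub, toPoly_t_pow, ← neg_sub, degree_neg]
  exact degree_sub_lt_left (by rw [degree_X_pow, degree_eq_natDegree hf.ne_zero]) hf.ne_zero
    (by rw [hf, leadingCoeff_X_pow])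

theorem mul_mem_span_of_mul_assoc (hf : (toPoly f).Monic) (hn : 1 < (toPoly f).natDegree)
    (hassoc : ∀ a b c : PetitAlgebra f, a * b * c = a * (b * c)) {c : DiffPoly δ}
    (hc : c ∈ remainders f) : f * c ∈ Ideal.span {f} := by
  have hf0 : f ≠ 0 := mt (toPoly_eq_zero_iff f).2 hf.ne_zero
  let a : PetitAlgebra f := ⟨t δ ^ ((toPoly f).natDegree - 1), t_pow_mem_remainders (by omega)⟩
  let b : PetitAlgebra f := ⟨t δ ^ 1, t_pow_mem_remainders hn⟩
  have hab : a.1 * b.1 = t δ ^ (toPoly f).natDegree := by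
    rw [← pow_add, Nat.sub_add_cancel hn.le]
  have h := (mul_assoc_iff hf0 a b ⟨c, hc⟩).1 (hassoc _ _ _)
  rwa [← mk_val_mul_val, hab, val_mk_t_pow_natDegree hf, sub_sub_cancel] at h

end PetitAlgebra

end PetitAlgebras

section Translations

variable {L : Type*} [Field L] {δ : Der L} {c : L}

theorem coeffDer_X_add_C_pow (hc : δ c = 0) (n : ℕ) : coeffDer δ ((X + C c) ^ n) = 0 := by
  rw [Derivation.leibniz_pow, map_add, coeffDer_X, coeffDer_C, hc, C_0, add_zero, smul_zero,
    smul_zero]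

theorem coeffDer_taylor (hc : δ c = 0) (g : L[X]) :
    coeffDer δ (taylor c g) = taylor c (coeffDer δ g) := by
  induction g using Polynomial.induction_on' with
  | add g h hg hh => rw [map_add, map_add, hg, hh, map_add, map_add]
  | monomial n b =>
    rw [taylor_monomial, Derivation.leibniz, coeffDer_X_add_C_pow hc, coeffDer_C, smul_zero,
      zero_add, ← C_mul_X_pow_eq_monomial, Derivation.leibniz, Derivation.leibniz_pow, coeffDer_X,
      coeffDer_C, smul_zero, smul_zero, smul_zero, zero_add, smul_eq_mul, smul_eq_mul, taylor_mul,
      taylor_C, taylor_X_pow]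

namespace DiffPoly

/-- The substitution `t ↦ t + c`, which is multiplicative on `L[t;δ]` for constant `c`. -/
noncomputable def shift (c : L) : DiffPoly δ →ₗ[L] DiffPoly δ :=
  toPoly.symm.toLinearMap ∘ₗ taylor c ∘ₗ toPoly.toLinearMap

theorem toPoly_shift (c : L) (f : DiffPoly δ) : toPoly (shift c f) = taylor c (toPoly f) := rfl

theorem degree_shift (c : L) (f : DiffPoly δ) : (shift c f).degree = f.degree :=
  degree_taylor _ _

theorem shift_zero (f : DiffPoly δ) : shift 0 f = f := taylor_zero _

theorem shift_shift (c d : L) (f : DiffPoly δ) : shift c (shift d f) = shift (c + d) f :=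
  taylor_taylor _ _ _

theorem shift_one (c : L) : shift c (1 : DiffPoly δ) = 1 := taylor_one _

theorem shift_t (c : L) : shift c (t δ) = t δ + scal δ c := toPoly.injective (taylor_X c)

theorem shift_t_mul (hc : δ c = 0) (g : DiffPoly δ) :
    shift c (t δ * g) = (t δ + scal δ c) * shift c g := by
  apply toPoly.injective
  rw [toPoly_shift, toPoly_t_mul, map_add, taylor_mul, taylor_X, ← coeffDer_taylor hc,
    add_mul (t δ), scal_mul, map_add, toPoly_t_mul, map_smul, toPoly_shift, smul_eq_C_mul]
  ring

theorem shift_t_pow_mul (hc : δ c = 0) (n : ℕ) (g : DiffPoly δ) :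
    shift c (t δ ^ n * g) = (t δ + scal δ c) ^ n * shift c g := by
  induction n with
  | zero => rw [pow_zero, pow_zero, one_mul, one_mul]
  | succ n ih => rw [pow_succ', mul_assoc, shift_t_mul hc, ih, pow_succ', mul_assoc]

theorem shift_mul (hc : δ c = 0) (f g : DiffPoly δ) :
    shift c (f * g) = shift c f * shift c g := by
  induction f using induction_on with
  | smul_t_pow a n =>
    have ht := shift_t_pow_mul hc n 1
    rw [mul_one, shift_one, mul_one] at ht
    rw [smul_mul_assoc, map_smul, shift_t_pow_mul hc, map_smul, ht, smul_mul_assoc]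
  | add f h hf hh => rw [add_mul, map_add, hf, hh, map_add, add_mul]

theorem shift_cyclicPoly {p : ℕ} [Fact p.Prime] [CharP L p] (hc : c ^ p = c) (d : L) :
    shift c (cyclicPoly p δ d) = cyclicPoly p δ d := by
  apply toPoly.injective
  rw [toPoly_shift, toPoly_cyclicPoly, map_sub, map_sub, taylor_C, taylor_X_pow, taylor_X,
    add_pow_char, ← C_pow, hc, add_sub_add_right_eq_sub]

theorem modR_shift (hc : δ c = 0) {f : DiffPoly δ} (hf0 : f ≠ 0) (hf : shift c f = f)
    (g : DiffPoly δ) : modR f (shift c g) = shift c (modR f g) := by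
  obtain ⟨hdeg, q, hq⟩ := modR_spec f hf0 g
  refine modR_eq f (q := shift c q) (by rwa [degree_shift]) ?_
  conv_lhs => rw [hq, map_add, shift_mul hc, hf]

theorem shift_mem_remainders (c : L) {f g : DiffPoly δ} (hg : g ∈ remainders f) :
    shift c g ∈ remainders f := by
  rw [remainders, Submodule.mem_comap, mem_degreeLT] at hg ⊢
  exact (degree_taylor _ _).trans_lt hg

end DiffPoly

open DiffPoly

namespace PetitAlgebra

variable {f : DiffPoly δ}

/-- The automorphism of `R/Rf` induced by the substitution `t ↦ t + c`, for a constant `c` such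
that this substitution fixes `f`. -/
noncomputable def shiftAut (hc : δ c = 0) (hf0 : f ≠ 0) (hf : shift c f = f) :
    RingAut (PetitAlgebra f) where
  toFun a := ⟨shift c a.1, shift_mem_remainders c a.2⟩
  invFun a := ⟨shift (-c) a.1, shift_mem_remainders (-c) a.2⟩
  left_inv a := Subtype.ext <|
    (shift_shift _ _ _).trans (by rw [neg_add_cancel, shift_zero])
  right_inv a := Subtype.ext <|
    (shift_shift _ _ _).trans (by rw [add_neg_cancel, shift_zero])
  map_add' a b := Subtype.ext (map_add (shift c) a.1 b.1)
  map_mul' a b := Subtype.ext <|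
    (modR_shift hc hf0 hf _).symm.trans (congrArg (modR f) (shift_mul hc a.1 b.1))

theorem shiftAut_smul (hc : δ c = 0) (hf0 : f ≠ 0) (hf : shift c f = f) (b : L)
    (a : PetitAlgebra f) : shiftAut hc hf0 hf (b • a) = b • shiftAut hc hf0 hf a :=
  Subtype.ext (map_smul (shift c) b a.1)

theorem val_shiftAut_pow (hc : δ c = 0) (hf0 : f ≠ 0) (hf : shift c f = f) (n : ℕ)
    (a : PetitAlgebra f) : ((shiftAut hc hf0 hf ^ n) a).1 = shift (n * c) a.1 := by
  induction n with
  | zero =>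
    rw [Nat.cast_zero, zero_mul, shift_zero]
    rfl
  | succ n ih =>
    rw [pow_succ', Nat.cast_succ, add_mul, one_mul, add_comm, ← shift_shift, ← ih]
    rfl

theorem orderOf_shiftAut {p : ℕ} [Fact p.Prime] [CharP L p] (hc0 : c ≠ 0) (hc : δ c = 0)
    (hf0 : f ≠ 0) (hf : shift c f = f) (hn : 1 < (toPoly f).natDegree) :
    orderOf (shiftAut hc hf0 hf) = p := by
  refine orderOf_eq_prime (RingEquiv.ext fun a => Subtype.ext ?_) fun h => hc0 ?_
  · rw [val_shiftAut_pow, CharP.cast_eq_zero, zero_mul, shift_zero]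
    rfl
  · have ht : t δ ∈ remainders f := pow_one (t δ) ▸ t_pow_mem_remainders hn
    have hshift : shift c (t δ) = t δ := congrArg Subtype.val
      (RingEquiv.congr_fun h (⟨t δ, ht⟩ : PetitAlgebra f))
    rw [shift_t, add_eq_left] at hshift
    exact C_eq_zero.1 (congrArg toPoly hshift)

end PetitAlgebra

end Translations

section CyclicExtensions

open DiffPoly

namespace CyclicExt

variable {p : ℕ} [Fact p.Prime] {L : Type*} [Field L] [CharP L p] {δ : Der L} {d : L}

theorem not_assoc (hδ : ∀ a, δ^[p] a = δ a) (hd : δ d ≠ 0) :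
    ¬ ∀ a b c : CyclicExt p δ d, a * b * c = a * (b * c) := by
  intro hassoc
  have hn := one_lt_natDegree_cyclicPoly (δ := δ) (p := p) d
  have hft := PetitAlgebra.mul_mem_span_of_mul_assoc (monic_cyclicPoly d) hn hassoc
    (t_pow_mem_remainders hn)
  have hscal : δ d • (1 : DiffPoly δ) ∈ Ideal.span {cyclicPoly p δ d} := by
    rw [pow_one, cyclicPoly_mul_t hδ] at hft
    rw [← scal_mul, mul_one]
    exact (Ideal.add_mem_iff_right _
      (Ideal.mul_mem_left _ _ (Ideal.mem_span_singleton_self _))).1 hft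
  have hsmul : δ d • (1 : CyclicExt p δ d) = 0 :=
    (map_smul (PetitAlgebra.mk _) _ _).symm.trans
      ((PetitAlgebra.mk_eq_zero_iff (cyclicPoly_ne_zero d)).2 hscal)
  have := PetitAlgebra.nontrivial (zero_lt_one.trans hn)
  exact (smul_ne_zero hd one_ne_zero) hsmul

theorem isNonassocCyclicExtension (hdiv : IsDivisionAlgebra (constField δ) (CyclicExt p δ d)) :
    IsNonassocCyclicExtension p (constField δ) L (CyclicExt p δ d) where
  division := hdiv
  embed_injective := by
    have := hdiv.nontrivial
    exact smul_left_injective L one_ne_zero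
  embed_mul a b := by rw [smul_mul_assoc, one_mul, mul_smul]
  smul_eq_embed_mul a y := by rw [smul_mul_assoc, one_mul]
  finrank_eq := by rw [PetitAlgebra.finrank_eq, natDegree_cyclicPoly]
  exists_cyclic := by
    let σ : RingAut (CyclicExt p δ d) := PetitAlgebra.shiftAut δ.map_one_eq_zero
      (cyclicPoly_ne_zero d) (shift_cyclicPoly (one_pow p) d)
    have hσ : Subgroup.zpowers σ ≤ algAut L (CyclicExt p δ d) :=
      Subgroup.zpowers_le.2 (PetitAlgebra.shiftAut_smul _ _ _)
    refine ⟨Subgroup.zpowers σ, fun τ hτ c a => hσ hτ (c : L) a, inferInstance, ?_,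
      fun τ hτ a => ?_⟩
    · rw [Nat.card_zpowers, PetitAlgebra.orderOf_shiftAut one_ne_zero _ _ _
        (one_lt_natDegree_cyclicPoly d)]
    · rw [hσ hτ a 1, map_one]

end CyclicExt

end CyclicExtensions

end PetitExt

theorem mainTheorem11 {p : ℕ} [Fact p.Prime] {K : Type*} [Field K] [CharP K p]
    (δ : PetitExt.Der K)
    (hδ : minpoly (PetitExt.constField δ) (PetitExt.constEnd δ) = Polynomial.X ^ p - Polynomial.X) :
    PetitExt.constField (PetitExt.ratDer δ) = PetitExt.ratSubfield (PetitExt.constField δ) ∧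
    minpoly (PetitExt.constField (PetitExt.ratDer δ)) (PetitExt.constEnd (PetitExt.ratDer δ)) =
      Polynomial.X ^ p - Polynomial.X ∧
    ∀ h : RatFunc K, h ∉ PetitExt.ratSubfield (PetitExt.constField δ) →
      Irreducible (PetitExt.cyclicPoly p (PetitExt.ratDer δ) h) ∧
      PetitExt.IsDivisionAlgebra (PetitExt.ratSubfield (PetitExt.constField δ))
        (PetitExt.CyclicExt p (PetitExt.ratDer δ) h) ∧
      (¬ ∀ a b c : PetitExt.CyclicExt p (PetitExt.ratDer δ) h, a * b * c = a * (b * c)) ∧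
      Module.finrank (PetitExt.ratSubfield (PetitExt.constField δ))
        (PetitExt.CyclicExt p (PetitExt.ratDer δ) h) = p ^ 2 ∧
      PetitExt.IsNonassocCyclicExtension p (PetitExt.ratSubfield (PetitExt.constField δ))
        (RatFunc K) (PetitExt.CyclicExt p (PetitExt.ratDer δ) h) := by
  have hp : p.Prime := Fact.out
  have : NeZero p := ⟨hp.ne_zero⟩
  have hpow := PetitExt.ratDer_iterate_eq (PetitExt.iterate_eq_of_minpoly hδ)
  obtain ⟨u, hu0, hu⟩ := PetitExt.exists_eigenvector_of_minpoly hδ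
  have hv0 : RatFunc.C u ≠ 0 := (_root_.map_ne_zero _).2 hu0
  have hv : PetitExt.ratDer δ (RatFunc.C u) = RatFunc.C u := by rw [PetitExt.ratDer_C, hu]
  have hconst := PetitExt.constField_ratDer (δ := δ) p
  have hrank := PetitExt.finrank_constField hpow hv0 hv
  refine ⟨hconst, PetitExt.minpoly_constEnd_eq hpow hv0 hv, ?_⟩
  rw [← hconst]
  intro h hh
  have : Module.Finite (PetitExt.constField (PetitExt.ratDer δ)) (RatFunc K) :=
    Module.finite_of_finrank_pos (hrank ▸ hp.pos)
  have hirr := PetitExt.DiffPoly.irreducible_cyclicPoly hpow hh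
  have hdiv := PetitExt.PetitAlgebra.isDivisionAlgebra hirr
  refine ⟨hirr, hdiv, PetitExt.CyclicExt.not_assoc hpow hh, ?_,
    PetitExt.CyclicExt.isNonassocCyclicExtension hdiv⟩
  rw [← Module.finrank_mul_finrank _ (RatFunc K), hrank, PetitExt.PetitAlgebra.finrank_eq,
    PetitExt.DiffPoly.natDegree_cyclicPoly, sq]
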